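/- Let $D=(V,E)$ be a finite digraph without self-loops, of order $n=|V|\ge 1$. Let $d^+(v)$ be the out-degree of a vertex $v$, let $A(D)=(a_{uv})$ be the adjacency matrix ($a_{uv}=1$ if $u\to v$ is an arc and $a_{uv}=0$ otherwise), and let $\mathrm{Deg}(D)$ be the diagonal matrix of the out-degrees. For $\alpha\in[0,1]$ put $A_\alpha(D)=\alpha\,\mathrm{Deg}(D)+(1-\alpha)A(D)$, and let $\rho(A_\alpha(D))$ be its spectral radius, i.e. the largest modulus of a complex eigenvalue. Let $Z=\sum_{v\in V}d^+(v)^2$, and let $c_2=\sum_{u\in V}\sum_{v\in V:\,u\sim v}a_{uv}a_{vu}$ be the number of closed walks of length $2$ in $D$, where $u\sim v$ means that $u\to v$ or $v\to u$ is an arc. Then $$\rho(A_\alpha(D))\ \ge\ \sqrt{\frac{\alpha^2 Z+(1-\alpha)^2c_2}{n}} .$$ Equality holds if and only if one of the following occurs: (i) $\alpha=0$ and either $D$ is a directed acyclic graph (it has no directed cycle, where a pair of opposite arcs counts as a directed cycle), or every strong component of $D$ is a digon (two distinct vertices joined by arcs in both directions); (ii) $0<\alpha<1$ and $D$ has no arcs;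 (iii) $\alpha=1$ and $D$ is out-regular, i.e. $d^+(v)$ is the same for all $v\in V$. -/

import Mathlib

namespace Digraph

variable {V : Type*}

/-- A digraph without self-loops. -/
def Loopless (D : Digraph V) : Prop := ∀ v, ¬ D.Adj v v

/-- A directed acyclic graph: no vertex can be reached from itself by a directed walk of positive
length. (Digons count as directed cycles.) -/
def IsDAG (D : Digraph V) : Prop := ∀ v, ¬ Relation.TransGen D.Adj v v

/-- `S` is the vertex set of a strong component: an equivalence class of the relation "each of the
two vertices is reachable from the other by a (possibly trivial) directed walk". -/
def IsStrongComponent (D : Digraph V) (S : Set V) : Prop :=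
  ∃ v, S = {w | Relation.ReflTransGen D.Adj v w ∧ Relation.ReflTransGen D.Adj w v}

/-- In a loopless digraph: the subdigraph induced on `S` is a digon, that is, `S` consists of two
distinct vertices joined by arcs in both directions. -/
def InducesDigon (D : Digraph V) (S : Set V) : Prop :=
  ∃ u v, u ≠ v ∧ S = {u, v} ∧ D.Adj u v ∧ D.Adj v u

section Fintype

variable [Fintype V]

open Classical in
/-- The out-degree `d⁺(v)`. -/
noncomputable def outDegree (D : Digraph V) (v : V) : ℕ :=
  (Finset.univ.filter fun w => D.Adj v w).card

/-- All out-degrees are equal. -/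
def IsOutRegular (D : Digraph V) : Prop := ∃ d : ℕ, ∀ v, D.outDegree v = d

open Classical in
/-- The adjacency matrix. -/
noncomputable def adjMatrix (D : Digraph V) : Matrix V V ℝ :=
  Matrix.of fun u v => if D.Adj u v then 1 else 0

/-- The first out-degree Zagreb index `Z = ∑ᵥ d⁺(v)²`. -/
noncomputable def zagreb (D : Digraph V) : ℝ := ∑ v, (D.outDegree v : ℝ) ^ 2

open Classical in
/-- The number `c₂` of closed walks of length two, as the sum of `A u v * A v u` over the ordered
pairs `(u, v)` joined by an arc in at least one direction. -/
noncomputable def closedWalksTwo (D : Digraph V) : ℝ :=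
  ∑ u, ∑ v ∈ Finset.univ.filter (fun v => D.Adj u v ∨ D.Adj v u),
    D.adjMatrix u v * D.adjMatrix v u

variable [DecidableEq V]

/-- The matrix `A_α(D) = α Deg(D) + (1 - α) A(D)`. -/
noncomputable def alphaMatrix (D : Digraph V) (α : ℝ) : Matrix V V ℝ :=
  α • Matrix.diagonal (fun v => (D.outDegree v : ℝ)) + (1 - α) • D.adjMatrix

/-- The spectral radius of `A_α(D)`: the largest modulus of a complex eigenvalue. -/
noncomputable def alphaSpectralRadius (D : Digraph V) (α : ℝ) : ℝ :=
  (spectralRadius ℂ ((D.alphaMatrix α).map Complex.ofReal)).toReal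

end Fintype

end Digraph

/-! Put `M = A_α ^ 2` and `r = ρ ^ 2`. Since the digraph has no loops, `tr M = α² Z + (1 - α)² c₂`,
and a trace is at most `n` times the largest eigenvalue modulus; this is the bound. In case of
equality `tr M = n r`, while `tr (M ^ k) ≤ n r ^ k` for all `k > 0`. Nonnegativity of `M` and a
variance argument at `k = 2` force `M v v = r` for all `v`; higher powers then show that no positive
off-diagonal entry of `M` lies on a closed walk (`eq_of_pow_apply_pos_of_trace_pow_le`). So a
two-step walk that can be closed up evenly returns to its start, which settles each range of `α`.
Conversely, in each listed case `A_α ^ k - s ^ k` has acyclic support for suitable `k`, `s`, so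
every eigenvalue has modulus `s`. -/

namespace Matrix

variable {n : Type*} [Fintype n] [DecidableEq n]

/-! ### Eigenvalues, traces and acyclic support -/

section Spectrum

/-- Every eigenvalue of a complex matrix is bounded by its spectral radius. -/
theorem norm_le_spectralRadius_toReal (Q : Matrix n n ℂ) {z : ℂ} (hz : z ∈ spectrum ℂ Q) :
    ‖z‖ ≤ (spectralRadius ℂ Q).toReal := by
  have hfin : spectralRadius ℂ Q ≠ ⊤ := by
    obtain ⟨C, hC⟩ := (Q.finite_spectrum.image fun z => ‖z‖₊).bddAbove
    refine ne_top_of_le_ne_top (ENNReal.coe_ne_top (r := C)) (iSup₂_le fun k hk => ?_)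
    exact ENNReal.coe_le_coe.2 (hC ⟨k, hk, rfl⟩)
  have h : (‖z‖₊ : ENNReal) ≤ spectralRadius ℂ Q :=
    le_iSup₂ (f := fun (k : ℂ) (_ : k ∈ spectrum ℂ Q) => (‖k‖₊ : ENNReal)) z hz
  simpa using ENNReal.toReal_mono hfin h

theorem spectralRadius_toReal_le (Q : Matrix n n ℂ) {s : ℝ} (hs : 0 ≤ s)
    (h : ∀ z ∈ spectrum ℂ Q, ‖z‖ ≤ s) : (spectralRadius ℂ Q).toReal ≤ s := by
  refine ENNReal.toReal_le_of_le_ofReal hs (iSup₂_le fun k hk => ?_)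
  rw [← ENNReal.ofReal_coe_nnreal]
  exact ENNReal.ofReal_le_ofReal (h k hk)

theorem norm_trace_le (Q : Matrix n n ℂ) {s : ℝ} (h : ∀ z ∈ spectrum ℂ Q, ‖z‖ ≤ s) :
    ‖Q.trace‖ ≤ Fintype.card n * s := by
  rw [trace_eq_sum_roots_charpoly]
  refine (norm_multiset_sum_le _).trans ?_
  refine (Multiset.sum_le_card_nsmul _ s fun x hx => ?_).trans ?_
  · obtain ⟨z, hz, rfl⟩ := Multiset.mem_map.1 hx
    exact h z (mem_spectrum_of_isRoot_charpoly (Polynomial.isRoot_of_mem_roots hz))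
  · rw [Multiset.card_map, IsAlgClosed.card_roots_eq_natDegree, charpoly_natDegree_eq_dim,
      nsmul_eq_mul]

/-- The trace of a power of a real matrix is at most the order times the corresponding power of
the spectral radius. -/
theorem trace_pow_le (P : Matrix n n ℝ) {k : ℕ} (hk : 0 < k) :
    (P ^ k).trace ≤
      Fintype.card n * (spectralRadius ℂ (P.map Complex.ofReal)).toReal ^ k := by
  have h := norm_trace_le ((P.map Complex.ofReal) ^ k)
    (s := (spectralRadius ℂ (P.map Complex.ofReal)).toReal ^ k) (by
      rw [spectrum.map_pow_of_pos _ hk]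
      rintro _ ⟨z, hz, rfl⟩
      simpa using pow_le_pow_left₀ (norm_nonneg z) (norm_le_spectralRadius_toReal _ hz) k)
  have e : ((P.map Complex.ofReal) ^ k).trace = ((P ^ k).trace : ℂ) := by
    have : (P.map Complex.ofReal) ^ k = (P ^ k).map Complex.ofReal :=
      (map_pow (Complex.ofRealHom.mapMatrix (m := n)) P k).symm
    rw [this]
    simp [trace]
  rw [e, Complex.norm_real] at h
  exact (le_abs_self _).trans h

omit [DecidableEq n] in
/-- A matrix whose support is an acyclic relation has no nonzero eigenvalue. -/
theorem eq_zero_of_mulVec_eq_smul_of_acyclic {K : Type*} [Field K] {B : Matrix n n K}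
    (hB : ∀ v, ¬ Relation.TransGen (fun i j => B i j ≠ 0) v v) {f : n → K} (hf : f ≠ 0) {μ : K}
    (h : B *ᵥ f = μ • f) : μ = 0 := by
  by_contra hμ
  -- Reversing the arcs makes successors smaller: `(B *ᵥ f) v` only involves `f` at successors of
  -- `v`, where it vanishes by induction.
  have hirr : Std.Irrefl (Relation.TransGen fun i j => B j i ≠ 0) :=
    ⟨fun v hv => hB v (Relation.transGen_swap.1 hv)⟩
  have hwf : WellFounded (Relation.TransGen fun i j => B j i ≠ 0) :=
    Finite.wellFounded_of_trans_of_irrefl _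
  have key : ∀ v, f v = 0 := fun v => by
    induction v using hwf.induction with
    | _ v ih =>
      have hv := congrFun h v
      rw [mulVec, dotProduct, Finset.sum_eq_zero] at hv
      · simpa [hμ] using hv.symm
      · intro w _
        by_cases hw : B v w = 0
        · simp [hw]
        · simp [ih w (.single hw)]
  exact hf (funext key)

theorem exists_mulVec_eq_smul_of_mem_spectrum {K : Type*} [Field K] {Q : Matrix n n K} {z : K}
    (hz : z ∈ spectrum K Q) : ∃ f : n → K, f ≠ 0 ∧ Q *ᵥ f = z • f := by
  rw [← spectrum_toLin', ← Module.End.hasEigenvalue_iff_mem_spectrum] at hz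
  obtain ⟨f, hf⟩ := hz.exists_hasEigenvector
  exact ⟨f, hf.2, by simpa using hf.apply_eq_smul⟩

end Spectrum

/-! ### Rigidity of nonnegative matrices with extremal traces -/

section Nonneg

variable {A B M P : Matrix n n ℝ}

omit [DecidableEq n] in
theorem mul_apply_pos (hA : ∀ i j, 0 ≤ A i j) (hB : ∀ i j, 0 ≤ B i j) {i j k : n}
    (h₁ : 0 < A i j) (h₂ : 0 < B j k) : 0 < (A * B) i k := by
  rw [mul_apply]
  exact Finset.sum_pos' (fun l _ => mul_nonneg (hA i l) (hB l k))
    ⟨j, Finset.mem_univ j, mul_pos h₁ h₂⟩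

theorem pow_apply_nonneg_of_nonneg (hA : ∀ i j, 0 ≤ A i j) (k : ℕ) (i j : n) :
    0 ≤ (A ^ k) i j := by
  induction k generalizing i j with
  | zero => rw [pow_zero, one_apply]; split_ifs <;> norm_num
  | succ k ih =>
    rw [pow_succ, mul_apply]
    exact Finset.sum_nonneg fun l _ => mul_nonneg (ih i l) (hA l j)

theorem pow_add_apply_pos (hA : ∀ i j, 0 ≤ A i j) {a b : ℕ} {i j k : n}
    (h₁ : 0 < (A ^ a) i j) (h₂ : 0 < (A ^ b) j k) : 0 < (A ^ (a + b)) i k := by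
  rw [pow_add]
  exact mul_apply_pos (pow_apply_nonneg_of_nonneg hA a) (pow_apply_nonneg_of_nonneg hA b) h₁ h₂

theorem exists_pow_apply_pos_of_reflTransGen (hA : ∀ i j, 0 ≤ A i j) {r : n → n → Prop}
    (hr : ∀ i j, r i j → 0 < A i j) {i j : n} (h : Relation.ReflTransGen r i j) :
    ∃ k, 0 < (A ^ k) i j := by
  induction h with
  | refl => exact ⟨0, by simp⟩
  | tail _ hbc ih =>
    obtain ⟨k, hk⟩ := ih
    exact ⟨k + 1, pow_add_apply_pos hA hk (by simpa using hr _ _ hbc)⟩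

theorem exists_pow_succ_apply_pos_of_transGen (hA : ∀ i j, 0 ≤ A i j) {r : n → n → Prop}
    (hr : ∀ i j, r i j → 0 < A i j) {i j : n} (h : Relation.TransGen r i j) :
    ∃ k, 0 < (A ^ (k + 1)) i j := by
  obtain ⟨b, hb, hbj⟩ := Relation.TransGen.tail'_iff.1 h
  obtain ⟨k, hk⟩ := exists_pow_apply_pos_of_reflTransGen hA hr hb
  exact ⟨k, pow_add_apply_pos hA hk (by simpa using hr _ _ hbj)⟩

/-- If the traces of the powers of `M` are bounded like those of `r • 1`, with equality for `M`
itself, then `M` has constant diagonal. -/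
theorem diag_eq_of_trace_pow_le (hM : ∀ i j, 0 ≤ M i j) {r : ℝ}
    (h₁ : M.trace = Fintype.card n * r) (h₂ : (M ^ 2).trace ≤ Fintype.card n * r ^ 2) (v : n) :
    M v v = r := by
  have h₃ : ∑ i, M i i ^ 2 ≤ (M ^ 2).trace := by
    refine Finset.sum_le_sum fun i _ => ?_
    rw [diag_apply, pow_two M, mul_apply, sq]
    exact Finset.single_le_sum (f := fun j => M i j * M j i)
      (fun j _ => mul_nonneg (hM i j) (hM j i)) (Finset.mem_univ i)
  have h₄ : ∑ i, (M i i - r) ^ 2 = ∑ i, M i i ^ 2 - 2 * r * M.trace + Fintype.card n * r ^ 2 := by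
    simp only [sub_sq, Finset.sum_add_distrib, Finset.sum_sub_distrib, trace, diag_apply,
      Finset.mul_sum, Finset.sum_const, Finset.card_univ, nsmul_eq_mul]
    congr 2
    exact Finset.sum_congr rfl fun i _ => by ring
  -- With `tr M = n r` the sum is `∑ M i i ^ 2 - n r ^ 2`, which `h₃` and `h₂` make nonpositive.
  have h₅ : ∑ i, (M i i - r) ^ 2 = 0 :=
    le_antisymm (by rw [h₄, h₁]; nlinarith) (Finset.sum_nonneg fun i _ => sq_nonneg _)
  have h₆ := (Finset.sum_eq_zero_iff_of_nonneg fun i _ => sq_nonneg (M i i - r)).1 h₅ v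
    (Finset.mem_univ v)
  exact sub_eq_zero.1 (pow_eq_zero_iff two_ne_zero |>.1 h₆)

theorem pow_le_pow_apply_self (hM : ∀ i j, 0 ≤ M i j) (v : n) (k : ℕ) :
    M v v ^ k ≤ (M ^ k) v v := by
  induction k with
  | zero => simp
  | succ k ih =>
    rw [pow_succ, pow_succ, mul_apply]
    exact (mul_le_mul_of_nonneg_right ih (hM v v)).trans
      (Finset.single_le_sum (f := fun j => (M ^ k) v j * M j v)
        (fun j _ => mul_nonneg (pow_apply_nonneg_of_nonneg hM k v j) (hM j v)) (Finset.mem_univ v))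

theorem pow_diag_eq_of_trace_pow_le (hM : ∀ i j, 0 ≤ M i j) {r : ℝ}
    (h₁ : M.trace = Fintype.card n * r)
    (h₂ : ∀ k, 0 < k → (M ^ k).trace ≤ Fintype.card n * r ^ k) (v : n) (k : ℕ) :
    (M ^ k) v v = r ^ k := by
  rcases Nat.eq_zero_or_pos k with rfl | hk
  · simp
  have hle : ∀ i ∈ Finset.univ, r ^ k ≤ (M ^ k) i i := fun i _ => by
    simpa [diag_eq_of_trace_pow_le hM h₁ (h₂ 2 two_pos) i] using pow_le_pow_apply_self hM i k
  refine ((Finset.sum_eq_sum_iff_of_le hle).1 (le_antisymm (Finset.sum_le_sum hle) ?_) v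
    (Finset.mem_univ v)).symm
  simpa [trace] using h₂ k hk

/-- Under the trace bounds of `pow_diag_eq_of_trace_pow_le`, no positive off-diagonal entry of `M`
lies on a closed walk. -/
theorem eq_of_pow_apply_pos_of_trace_pow_le (hM : ∀ i j, 0 ≤ M i j) {r : ℝ}
    (h₁ : M.trace = Fintype.card n * r)
    (h₂ : ∀ k, 0 < k → (M ^ k).trace ≤ Fintype.card n * r ^ k) {x z : n} {j : ℕ}
    (hxz : 0 < M x z) (hzx : 0 < (M ^ j) z x) : x = z := by
  by_contra hne
  have hd := pow_diag_eq_of_trace_pow_le hM h₁ h₂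
  have h := hd x (j + 1)
  rw [pow_succ', mul_apply] at h
  -- The term `l = x` is already `r * r ^ j`, the whole of `(M ^ (j + 1)) x x`, leaving no room for
  -- a positive term at `z`.
  have hle : ∑ l ∈ {x, z}, M x l * (M ^ j) l x ≤ ∑ l, M x l * (M ^ j) l x :=
    Finset.sum_le_sum_of_subset_of_nonneg (Finset.subset_univ _)
      fun l _ _ => mul_nonneg (hM x l) (pow_apply_nonneg_of_nonneg hM j l x)
  rw [Finset.sum_pair hne, h, hd x j, pow_succ'] at hle
  have hx : M x x = r := by simpa using hd x 1
  rw [hx] at hle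
  linarith [mul_pos hxz hzx]

end Nonneg

end Matrix

/-! ### The matrix `A_α` and the lower bound -/

namespace Digraph

open Matrix

variable {V : Type*} {D : Digraph V}

theorem exists_digon_partner
    (h : ∀ S : Set V, D.IsStrongComponent S → D.InducesDigon S) (v : V) :
    ∃ u, u ≠ v ∧ D.Adj u v ∧ D.Adj v u ∧
      ∀ w, Relation.ReflTransGen D.Adj v w → Relation.ReflTransGen D.Adj w v → w = v ∨ w = u := by
  obtain ⟨a, b, hab, hS, h₁, h₂⟩ := h _ ⟨v, rfl⟩
  have hmem : ∀ w, Relation.ReflTransGen D.Adj v w → Relation.ReflTransGen D.Adj w v →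
      w = a ∨ w = b := fun w h₁ h₂ => by
    have : w ∈ ({a, b} : Set V) := hS ▸ (show w ∈ {w | _ ∧ _} from ⟨h₁, h₂⟩)
    simpa using this
  rcases hmem v .refl .refl with rfl | rfl
  · exact ⟨b, hab.symm, h₂, h₁, hmem⟩
  · exact ⟨a, hab, h₁, h₂, fun w h₃ h₄ => (hmem w h₃ h₄).symm⟩

variable [Fintype V]

omit [Fintype V] in
theorem adjMatrix_eq_one {u v : V} (h : D.Adj u v) : D.adjMatrix u v = 1 := by
  simp [adjMatrix, h]

omit [Fintype V] in
theorem adjMatrix_eq_zero {u v : V} (h : ¬ D.Adj u v) : D.adjMatrix u v = 0 := by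
  simp [adjMatrix, h]

omit [Fintype V] in
theorem adjMatrix_nonneg (u v : V) : 0 ≤ D.adjMatrix u v := by
  by_cases h : D.Adj u v
  · simp [adjMatrix_eq_one h]
  · simp [adjMatrix_eq_zero h]

omit [Fintype V] in
theorem adj_of_adjMatrix_ne_zero {u v : V} (h : D.adjMatrix u v ≠ 0) : D.Adj u v :=
  not_imp_comm.1 adjMatrix_eq_zero h

theorem closedWalksTwo_eq_sum :
    D.closedWalksTwo = ∑ u, ∑ v, D.adjMatrix u v * D.adjMatrix v u := by
  classical
  refine Finset.sum_congr rfl fun u _ => ?_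
  refine (Finset.sum_subset (Finset.subset_univ _) fun v _ hv => ?_)
  rw [adjMatrix_eq_zero, zero_mul]
  exact fun h => hv (by simp [h])

theorem outDegree_pos {u v : V} (h : D.Adj u v) : 0 < D.outDegree u :=
  Finset.card_pos.2 ⟨v, by simpa using h⟩

theorem exists_adj_of_outDegree_pos {u : V} (h : 0 < D.outDegree u) : ∃ v, D.Adj u v := by
  obtain ⟨v, hv⟩ := Finset.card_pos.1 h
  exact ⟨v, by simpa using hv⟩

variable [DecidableEq V] {α : ℝ}

theorem alphaMatrix_apply (u v : V) : D.alphaMatrix α u v =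
    (if u = v then α * D.outDegree u else 0) + (1 - α) * D.adjMatrix u v := by
  simp [alphaMatrix, diagonal_apply]

theorem alphaMatrix_nonneg (hα : α ∈ Set.Icc (0 : ℝ) 1) (u v : V) : 0 ≤ D.alphaMatrix α u v := by
  rw [alphaMatrix_apply]
  have h₁ := mul_nonneg (sub_nonneg.2 hα.2) (D.adjMatrix_nonneg u v)
  have h₂ := mul_nonneg hα.1 (Nat.cast_nonneg (α := ℝ) (D.outDegree u))
  split_ifs <;> linarith

theorem alphaMatrix_zero : D.alphaMatrix 0 = D.adjMatrix := by
  simp [alphaMatrix]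

theorem alphaMatrix_sq_apply_self (hD : D.Loopless) (v : V) : (D.alphaMatrix α ^ 2) v v =
    α ^ 2 * (D.outDegree v : ℝ) ^ 2 + (1 - α) ^ 2 * ∑ w, D.adjMatrix v w * D.adjMatrix w v := by
  have h : ∀ w, D.alphaMatrix α v w * D.alphaMatrix α w v =
      (if v = w then α ^ 2 * (D.outDegree v : ℝ) ^ 2 else 0) +
        (1 - α) ^ 2 * (D.adjMatrix v w * D.adjMatrix w v) := fun w => by
    rw [alphaMatrix_apply, alphaMatrix_apply]
    by_cases hvw : v = w
    · subst hvw
      simp only [if_true, adjMatrix_eq_zero (hD v)]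
      ring
    · simp only [if_neg hvw, if_neg (Ne.symm hvw)]
      ring
  simp [sq (D.alphaMatrix α), mul_apply, h, Finset.sum_add_distrib, Finset.mul_sum]

theorem trace_alphaMatrix_sq (hD : D.Loopless) : (D.alphaMatrix α ^ 2).trace =
    α ^ 2 * D.zagreb + (1 - α) ^ 2 * D.closedWalksTwo := by
  simp only [trace, diag_apply, alphaMatrix_sq_apply_self hD, Finset.sum_add_distrib,
    ← Finset.mul_sum, zagreb, closedWalksTwo_eq_sum]

theorem alphaSpectralRadius_nonneg : 0 ≤ D.alphaSpectralRadius α := ENNReal.toReal_nonneg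

theorem sqrt_le_alphaSpectralRadius [Nonempty V] (hD : D.Loopless) :
    √((α ^ 2 * D.zagreb + (1 - α) ^ 2 * D.closedWalksTwo) / (Fintype.card V : ℝ)) ≤
      D.alphaSpectralRadius α := by
  refine Real.sqrt_le_iff.2 ⟨alphaSpectralRadius_nonneg, ?_⟩
  rw [div_le_iff₀' (by exact_mod_cast Fintype.card_pos), ← trace_alphaMatrix_sq hD]
  exact trace_pow_le _ two_pos

/-- If `A_α(D) ^ k - s ^ k` has acyclic support, then `ρ(A_α(D)) ≤ s`. -/
theorem alphaSpectralRadius_le_of_acyclic {k : ℕ} {s : ℝ} (hk : 0 < k) (hs : 0 ≤ s)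
    (h : ∀ v, ¬ Relation.TransGen
      (fun i j => (D.alphaMatrix α ^ k - scalar V (s ^ k)) i j ≠ 0) v v) :
    D.alphaSpectralRadius α ≤ s := by
  refine spectralRadius_toReal_le _ hs fun z hz => ?_
  have hz' : z ^ k ∈ spectrum ℂ ((D.alphaMatrix α).map Complex.ofReal ^ k) := by
    rw [spectrum.map_pow_of_pos _ hk]
    exact ⟨z, hz, rfl⟩
  obtain ⟨f, hf, hfz⟩ := exists_mulVec_eq_smul_of_mem_spectrum hz'
  have e : (D.alphaMatrix α ^ k - scalar V (s ^ k)).map Complex.ofReal =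
      (D.alphaMatrix α).map Complex.ofReal ^ k - scalar V ((s : ℂ) ^ k) := by
    have e₁ := map_pow (Complex.ofRealHom.mapMatrix (m := V)) (D.alphaMatrix α) k
    have e₂ : (D.alphaMatrix α).map Complex.ofReal ^ k =
      (D.alphaMatrix α ^ k).map Complex.ofReal := e₁.symm
    rw [e₂]
    ext i j
    by_cases hij : i = j <;> simp [scalar_apply, hij]
  have := eq_zero_of_mulVec_eq_smul_of_acyclic (K := ℂ)
    (B := (D.alphaMatrix α ^ k - scalar V (s ^ k)).map Complex.ofReal) (μ := z ^ k - (s : ℂ) ^ k)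
    (by simpa only [map_apply, ne_eq, Complex.ofReal_eq_zero] using h) hf (by
      rw [e, sub_mulVec, hfz, sub_smul]
      congr 1
      ext i
      simp [scalar_apply, mulVec_diagonal])
  have hn : ‖z‖ ^ k = s ^ k := by
    rw [← norm_pow, sub_eq_zero.1 this, norm_pow, Complex.norm_real, Real.norm_of_nonneg hs]
  exact ((pow_left_inj₀ (norm_nonneg z) hs hk.ne').1 hn).le

theorem trace_alphaMatrix_sq_pow_le (k : ℕ) (hk : 0 < k) : ((D.alphaMatrix α ^ 2) ^ k).trace ≤
    Fintype.card V * (D.alphaSpectralRadius α ^ 2) ^ k := by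
  rw [← pow_mul, ← pow_mul]
  exact trace_pow_le _ (Nat.mul_pos two_pos hk)

/-! ### Equality case: constant diagonal, and `0 < α < 1` -/

section Equality

variable (hD : D.Loopless) (hα : α ∈ Set.Icc (0 : ℝ) 1)
  (heq : (D.alphaMatrix α ^ 2).trace = Fintype.card V * D.alphaSpectralRadius α ^ 2)

include hα heq

theorem alphaMatrix_sq_apply_self_eq (v : V) :
    (D.alphaMatrix α ^ 2) v v = D.alphaSpectralRadius α ^ 2 :=
  diag_eq_of_trace_pow_le (pow_apply_nonneg_of_nonneg (alphaMatrix_nonneg hα) 2) heq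
    (trace_alphaMatrix_sq_pow_le 2 two_pos) v

/-- The return walk must have even length, being a walk of `A_α ^ 2`; the applications arrange this
parity. -/
theorem eq_of_alphaMatrix_pow_pos {x z : V} {j : ℕ} (hxz : 0 < (D.alphaMatrix α ^ 2) x z)
    (hzx : 0 < (D.alphaMatrix α ^ (2 * j)) z x) : x = z :=
  eq_of_pow_apply_pos_of_trace_pow_le (pow_apply_nonneg_of_nonneg (alphaMatrix_nonneg hα) 2) heq
    trace_alphaMatrix_sq_pow_le hxz (by rwa [← pow_mul])

include hD

theorem eq_bot_of_equality (h₀ : 0 < α) (h₁ : α < 1) : D = ⊥ := by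
  by_contra hne
  obtain ⟨a, b, hab⟩ : ∃ a b, D.Adj a b := by
    by_contra! h
    exact hne (by ext a b; simpa using h a b)
  have hdiag : ∀ v, D.alphaMatrix α v v = α * D.outDegree v := fun v => by
    simp [alphaMatrix_apply, adjMatrix_eq_zero (hD v)]
  have hnn := alphaMatrix_nonneg (D := D) hα
  have hsum : ∀ v, 0 ≤ ∑ w, D.adjMatrix v w * D.adjMatrix w v := fun v =>
    Finset.sum_nonneg fun w _ => mul_nonneg (D.adjMatrix_nonneg v w) (D.adjMatrix_nonneg w v)
  have hρ : 0 < D.alphaSpectralRadius α ^ 2 := by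
    rw [← alphaMatrix_sq_apply_self_eq hα heq a, alphaMatrix_sq_apply_self hD]
    have : (0 : ℝ) < D.outDegree a := by exact_mod_cast outDegree_pos hab
    have := hsum a
    positivity
  -- A sink would give a zero on the constant positive diagonal of `A_α ^ 2`.
  have hdeg : ∀ v, 0 < D.outDegree v := fun v => by
    by_contra! h
    have hv : D.outDegree v = 0 := by omega
    have := alphaMatrix_sq_apply_self_eq hα heq v
    rw [alphaMatrix_sq_apply_self hD, hv, Finset.sum_eq_zero] at this
    · simp [← this] at hρ
    · intro w _
      rw [adjMatrix_eq_zero, zero_mul]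
      exact fun hvw => (outDegree_pos hvw).ne' hv
  have hpos : ∀ v, 0 < D.alphaMatrix α v v := fun v => by
    rw [hdiag]
    have : (0 : ℝ) < D.outDegree v := by exact_mod_cast hdeg v
    positivity
  have hadj : ∀ u v, D.Adj u v → 0 < D.alphaMatrix α u v := fun u v h => by
    have : u ≠ v := by rintro rfl; exact hD u h
    simpa [alphaMatrix_apply, this, adjMatrix_eq_one h] using h₁
  have hacyc : ∀ v, ¬ Relation.TransGen D.Adj v v := fun v hv => by
    obtain ⟨w, hvw, hwv⟩ := Relation.TransGen.head'_iff.1 hv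
    obtain ⟨k, hk⟩ := exists_pow_apply_pos_of_reflTransGen hnn hadj hwv
    -- Positive diagonal entries allow waiting `k` steps at `v`, which makes the length even.
    have hk' : 0 < (D.alphaMatrix α ^ (2 * k)) w v := by
      rw [two_mul]
      exact pow_add_apply_pos hnn hk
        ((pow_pos (hpos v) k).trans_le (pow_le_pow_apply_self hnn v k))
    have hvw' : 0 < (D.alphaMatrix α ^ 2) v w := by
      rw [sq]
      exact mul_apply_pos hnn hnn (hpos v) (hadj v w hvw)
    have := eq_of_alphaMatrix_pow_pos hα heq hvw' hk'
    exact hD v (by rwa [← this] at hvw)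
  have hirr : Std.Irrefl (Relation.TransGen fun i j => D.Adj j i) :=
    ⟨fun v hv => hacyc v (Relation.transGen_swap.1 hv)⟩
  have hwf : WellFounded (Relation.TransGen fun i j => D.Adj j i) :=
    Finite.wellFounded_of_trans_of_irrefl _
  obtain ⟨m, -, hm⟩ := hwf.has_min Set.univ ⟨a, trivial⟩
  obtain ⟨w, hw⟩ := exists_adj_of_outDegree_pos (hdeg m)
  exact hm w trivial (.single hw)

end Equality

/-! ### Equality case: `α = 0` -/

section EqualityZero

variable (hD : D.Loopless)
  (heq : (D.alphaMatrix 0 ^ 2).trace = Fintype.card V * D.alphaSpectralRadius 0 ^ 2)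

include heq

theorem isDAG_of_equality (hρ : D.alphaSpectralRadius 0 = 0) : D.IsDAG := fun v hv => by
  have h₀ : (0 : ℝ) ∈ Set.Icc (0 : ℝ) 1 := ⟨le_rfl, zero_le_one⟩
  have hnn := alphaMatrix_nonneg (D := D) h₀
  obtain ⟨k, hk⟩ := exists_pow_succ_apply_pos_of_transGen hnn
    (fun u v h => by simp [alphaMatrix_zero, adjMatrix_eq_one h]) hv
  -- Going round twice makes the closed walk even, but even powers have zero diagonal when `ρ = 0`.
  have h := pow_add_apply_pos hnn hk hk
  have h' := pow_diag_eq_of_trace_pow_le (pow_apply_nonneg_of_nonneg hnn 2) heq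
    trace_alphaMatrix_sq_pow_le v (k + 1)
  rw [← pow_mul, two_mul, hρ] at h'
  simp [h'] at h

include hD

theorem adj_symm_of_equality {x y : V} (hxy : D.Adj x y) (hyx : Relation.ReflTransGen D.Adj y x) :
    D.Adj y x := by
  have h₀ : (0 : ℝ) ∈ Set.Icc (0 : ℝ) 1 := ⟨le_rfl, zero_le_one⟩
  have hnn := alphaMatrix_nonneg (D := D) h₀
  have hadj : ∀ u v, D.Adj u v → 0 < D.alphaMatrix 0 u v := fun u v h => by
    simp [alphaMatrix_zero, adjMatrix_eq_one h]
  obtain rfl | ⟨z, hyz, hzx⟩ := Relation.ReflTransGen.cases_head hyx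
  · exact (hD y hxy).elim
  · have hxz : 0 < (D.alphaMatrix 0 ^ 2) x z := by
      rw [sq]
      exact mul_apply_pos hnn hnn (hadj _ _ hxy) (hadj _ _ hyz)
    obtain ⟨k, hk⟩ := exists_pow_apply_pos_of_reflTransGen hnn hadj hzx
    -- The walk `z ⇝ x → y → z ⇝ x` has even length `k + 2 + k`, so `z = x`.
    have h := pow_add_apply_pos hnn (pow_add_apply_pos hnn hk hxz) hk
    rw [eq_of_alphaMatrix_pow_pos (j := k + 1) h₀ heq hxz (by convert h using 2; ring)]
    exact hyz

theorem inducesDigon_of_equality (hρ : D.alphaSpectralRadius 0 ≠ 0) (S : Set V)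
    (hS : D.IsStrongComponent S) : D.InducesDigon S := by
  have h₀ : (0 : ℝ) ∈ Set.Icc (0 : ℝ) 1 := ⟨le_rfl, zero_le_one⟩
  have hnn := alphaMatrix_nonneg (D := D) h₀
  have hadj : ∀ u v, D.Adj u v → 0 < D.alphaMatrix 0 u v := fun u v h => by
    simp [alphaMatrix_zero, adjMatrix_eq_one h]
  -- Two digons at `v` would put `w → v → w'` on a closed walk of length four.
  have huniq : ∀ {v w w'}, D.Adj v w → D.Adj w v → D.Adj v w' → D.Adj w' v → w = w' :=
    fun {v w w'} h₁ h₂ h₃ h₄ => by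
      refine eq_of_alphaMatrix_pow_pos (x := w) (z := w') (j := 1) h₀ heq ?_ ?_
      · rw [sq]
        exact mul_apply_pos hnn hnn (hadj _ _ h₂) (hadj _ _ h₃)
      · rw [mul_one, sq]
        exact mul_apply_pos hnn hnn (hadj _ _ h₄) (hadj _ _ h₁)
  obtain ⟨v, rfl⟩ := hS
  obtain ⟨u, hvu, huv⟩ : ∃ u, D.Adj v u ∧ D.Adj u v := by
    by_contra! h
    have := alphaMatrix_sq_apply_self_eq h₀ heq v
    rw [alphaMatrix_sq_apply_self hD, Finset.sum_eq_zero] at this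
    · exact hρ (by simpa using this.symm)
    · intro w _
      by_cases hvw : D.Adj v w
      · rw [adjMatrix_eq_zero (h w hvw), mul_zero]
      · rw [adjMatrix_eq_zero hvw, zero_mul]
  refine ⟨v, u, by rintro rfl; exact hD v hvu, Set.ext fun w => ?_, hvu, huv⟩
  simp only [Set.mem_ofPred_eq, Set.mem_insert_iff, Set.mem_singleton_iff]
  constructor
  · rintro ⟨h₁, h₂⟩
    induction h₁ with
    | refl => exact .inl rfl
    | @tail b c hvb hbc ih =>
      have hcb := adj_symm_of_equality hD heq hbc (h₂.trans hvb)
      rcases ih (.head hbc h₂) with rfl | rfl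
      · exact .inr (huniq hbc hcb hvu huv)
      · exact .inl (huniq hbc hcb huv hvu)
  · rintro (rfl | rfl)
    · exact ⟨.refl, .refl⟩
    · exact ⟨.single hvu, .single huv⟩

end EqualityZero

/-! ### Sufficiency of the listed cases -/

section Converse

theorem alphaSpectralRadius_zero_le_of_isDAG (h : D.IsDAG) : D.alphaSpectralRadius 0 ≤ 0 := by
  refine alphaSpectralRadius_le_of_acyclic one_pos le_rfl fun v hv => ?_
  refine h v (Relation.TransGen.mono (fun u w huw => ?_) v v hv)
  exact adj_of_adjMatrix_ne_zero (by simpa [alphaMatrix_zero] using huw)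

theorem closedWalksTwo_eq_card_of_inducesDigon
    (h : ∀ S : Set V, D.IsStrongComponent S → D.InducesDigon S) (hD : D.Loopless) :
    D.closedWalksTwo = Fintype.card V ∧ ∀ v, (D.alphaMatrix 0 ^ 2) v v = 1 := by
  have key : ∀ v, ∑ w, D.adjMatrix v w * D.adjMatrix w v = 1 := fun v => by
    obtain ⟨u, huv, h₁, h₂, hu⟩ := exists_digon_partner h v
    rw [Finset.sum_eq_single u, adjMatrix_eq_one h₁, adjMatrix_eq_one h₂, one_mul]
    · intro w _ hwu
      by_contra hne
      have hvw := adj_of_adjMatrix_ne_zero (left_ne_zero_of_mul hne)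
      have hwv := adj_of_adjMatrix_ne_zero (right_ne_zero_of_mul hne)
      rcases hu w (.single hvw) (.single hwv) with rfl | rfl
      · exact hD w hvw
      · exact hwu rfl
    · simp
  refine ⟨by simp [closedWalksTwo_eq_sum, key], fun v => ?_⟩
  simp [alphaMatrix_sq_apply_self hD, key]

/-- `A ^ 2` has unit diagonal, and a step `v → y → z` with `z ≠ v` on a cycle would stay in the
digon `{v, u}`; then `z = u`, and `y` would carry a loop. -/
theorem alphaSpectralRadius_zero_le_of_inducesDigon (hD : D.Loopless)
    (h : ∀ S : Set V, D.IsStrongComponent S → D.InducesDigon S) :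
    D.alphaSpectralRadius 0 ≤ 1 := by
  refine alphaSpectralRadius_le_of_acyclic two_pos zero_le_one fun v hv => ?_
  have hstep : ∀ x z, (D.alphaMatrix 0 ^ 2 - scalar V ((1 : ℝ) ^ 2)) x z ≠ 0 →
      x ≠ z ∧ ∃ y, D.Adj x y ∧ D.Adj y z := fun x z hxz => by
    have hne : x ≠ z := by
      rintro rfl
      simp [(closedWalksTwo_eq_card_of_inducesDigon h hD).2 x] at hxz
    refine ⟨hne, ?_⟩
    by_contra! hno
    refine hxz ?_
    rw [Matrix.sub_apply, scalar_apply, diagonal_apply_ne _ hne, sub_zero, alphaMatrix_zero, sq, mul_apply]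
    refine Finset.sum_eq_zero fun y _ => ?_
    by_cases hxy : D.Adj x y
    · rw [adjMatrix_eq_zero (hno y hxy), mul_zero]
    · rw [adjMatrix_eq_zero hxy, zero_mul]
  obtain ⟨z, hvz, hzv⟩ := Relation.TransGen.head'_iff.1 hv
  obtain ⟨hne, y, hvy, hyz⟩ := hstep v z hvz
  have hzv' : Relation.ReflTransGen D.Adj z v := by
    clear hv hvz hne hvy hyz
    induction hzv with
    | refl => exact .refl
    | tail _ hbc ih =>
      obtain ⟨-, y, h₁, h₂⟩ := hstep _ _ hbc
      exact (ih.tail h₁).tail h₂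
  obtain ⟨u, -, -, -, hu⟩ := exists_digon_partner h v
  have hyv : Relation.ReflTransGen D.Adj y v := .head hyz hzv'
  rcases hu z (.tail (.single hvy) hyz) hzv' with hz | hz
  · exact hne hz.symm
  · rcases hu y (.single hvy) hyv with hy | hy
    · exact hD v (by rwa [hy] at hvy)
    · exact hD u (by rwa [hy, hz] at hyz)

theorem alphaSpectralRadius_one_le {d : ℕ} (h : ∀ v, D.outDegree v = d) :
    D.alphaSpectralRadius 1 ≤ d := by
  refine alphaSpectralRadius_le_of_acyclic one_pos (Nat.cast_nonneg d) fun v hv => ?_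
  obtain ⟨w, hw, -⟩ := Relation.TransGen.head'_iff.1 hv
  refine hw ?_
  rw [Matrix.sub_apply, pow_one, pow_one, alphaMatrix_apply, scalar_apply, diagonal_apply, h]
  simp

theorem alphaSpectralRadius_bot_le : (⊥ : Digraph V).alphaSpectralRadius α ≤ 0 := by
  refine alphaSpectralRadius_le_of_acyclic one_pos le_rfl fun v hv => ?_
  obtain ⟨w, hw, -⟩ := Relation.TransGen.head'_iff.1 hv
  simp [alphaMatrix_apply, adjMatrix, outDegree] at hw

end Converse

end Digraph

theorem theorem3p3 {V : Type*} [Fintype V] [DecidableEq V] [Nonempty V]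
    (D : Digraph V) (hD : D.Loopless) (α : ℝ) (hα : α ∈ Set.Icc (0 : ℝ) 1) :
    √((α ^ 2 * D.zagreb + (1 - α) ^ 2 * D.closedWalksTwo) / (Fintype.card V : ℝ))
        ≤ D.alphaSpectralRadius α ∧
      (D.alphaSpectralRadius α =
          √((α ^ 2 * D.zagreb + (1 - α) ^ 2 * D.closedWalksTwo) / (Fintype.card V : ℝ)) ↔
        (α = 0 ∧ (D.IsDAG ∨ ∀ S : Set V, D.IsStrongComponent S → D.InducesDigon S)) ∨
        (0 < α ∧ α < 1 ∧ D = ⊥) ∨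
        (α = 1 ∧ D.IsOutRegular)) := by
  have hle := D.sqrt_le_alphaSpectralRadius (α := α) hD
  have hn : (0 : ℝ) < Fintype.card V := by exact_mod_cast Fintype.card_pos
  refine ⟨hle, fun h => ?_, fun h => le_antisymm ?_ hle⟩
  · have heq : (D.alphaMatrix α ^ 2).trace = Fintype.card V * D.alphaSpectralRadius α ^ 2 := by
      have h₀ : 0 ≤ (D.alphaMatrix α ^ 2).trace := Finset.sum_nonneg fun v _ =>
        Matrix.pow_apply_nonneg_of_nonneg (Digraph.alphaMatrix_nonneg hα) 2 v v
      rw [h, ← Digraph.trace_alphaMatrix_sq hD, Real.sq_sqrt (by positivity)]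
      field_simp
    rcases hα.1.eq_or_lt with rfl | h₀
    · refine .inl ⟨rfl, ?_⟩
      by_cases hρ : D.alphaSpectralRadius 0 = 0
      · exact .inl (Digraph.isDAG_of_equality heq hρ)
      · exact .inr (Digraph.inducesDigon_of_equality hD heq hρ)
    rcases hα.2.eq_or_lt with rfl | h₁
    · refine .inr (.inr ⟨rfl, ?_⟩)
      have hdeg : ∀ v, (D.outDegree v : ℝ) = D.alphaSpectralRadius 1 := fun v => by
        have := Digraph.alphaMatrix_sq_apply_self_eq hα heq v
        rw [Digraph.alphaMatrix_sq_apply_self hD] at this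
        exact (pow_left_inj₀ (Nat.cast_nonneg _) Digraph.alphaSpectralRadius_nonneg two_ne_zero).1
          (by simpa using this)
      obtain ⟨a⟩ := ‹Nonempty V›
      exact ⟨D.outDegree a, fun v => by exact_mod_cast (hdeg v).trans (hdeg a).symm⟩
    · exact .inr (.inl ⟨h₀, h₁, Digraph.eq_bot_of_equality hD hα heq h₀ h₁⟩)
  · rcases h with ⟨rfl, h | h⟩ | ⟨-, -, rfl⟩ | ⟨rfl, d, h⟩
    · exact (Digraph.alphaSpectralRadius_zero_le_of_isDAG h).trans (Real.sqrt_nonneg _)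
    · have hc := (Digraph.closedWalksTwo_eq_card_of_inducesDigon h hD).1
      simpa [hc, hn.ne'] using Digraph.alphaSpectralRadius_zero_le_of_inducesDigon hD h
    · exact Digraph.alphaSpectralRadius_bot_le.trans (Real.sqrt_nonneg _)
    · simpa [Digraph.zagreb, h, hn.ne'] using Digraph.alphaSpectralRadius_one_le h
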